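/- Theorem I. Let $\Bbbk$ be a field of characteristic zero; all spaces are finite-dimensional over $\Bbbk$ and $\tau$ denotes the flip $x\otimes y\mapsto y\otimes x$. Let $(D,\prec,\succ,\theta_\prec,\theta_\succ)$ be a dendriform $D$-bialgebra, that is: $(D,\prec,\succ)$ is a dendriform algebra, $$(x\prec y)\prec z=x\prec(y\prec z+y\succ z),\quad (x\succ y)\prec z=x\succ(y\prec z),\quad x\succ(y\succ z)=(x\prec y+x\succ y)\succ z;$$ $(D,\theta_\prec,\theta_\succ)$ is a dendriform coalgebra (with $\theta_\prec,\theta_\succ:D\to D\otimes D$ linear), $$(\theta_\prec\otimes\mathrm{id})\theta_\prec=(\mathrm{id}\otimes(\theta_\prec+\theta_\succ))\theta_\prec,\quad (\theta_\succ\otimes\mathrm{id})\theta_\prec=(\mathrm{id}\otimes\theta_\prec)\theta_\succ,\quad (\mathrm{id}\otimes\theta_\succ)\theta_\succ=((\theta_\prec+\theta_\succ)\otimes\mathrm{id})\theta_\succ;$$ and, writing $L_\prec(x)y=x\prec y$, $R_\prec(x)y=y\prec x$, $L_\succ(x)y=x\succ y$, $R_\succ(x)y=y\succ x$, $L=L_\prec+L_\succ$,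 $R=R_\prec+R_\succ$, $\theta=\theta_\prec+\theta_\succ$, for all $x,y\in D$: $$\theta_\prec(x\prec y+x\succ y)=(\mathrm{id}\otimes L_\succ(x))\theta_\prec(y)+(R(y)\otimes\mathrm{id})\theta_\prec(x),$$ $$\theta_\succ(x\prec y+x\succ y)=(\mathrm{id}\otimes L(x))\theta_\succ(y)+(R_\prec(y)\otimes\mathrm{id})\theta_\succ(x),$$ $$\theta(x\prec y)=(\mathrm{id}\otimes L_\prec(x))\theta_\succ(y)+(R_\prec(y)\otimes\mathrm{id})\theta(x),$$ $$\theta(x\succ y)=(\mathrm{id}\otimes L_\succ(x))\theta(y)+(R_\succ(y)\otimes\mathrm{id})\theta_\prec(x),$$ $$(L(x)\otimes\mathrm{id}-\mathrm{id}\otimes R_\prec(x))\theta_\prec(y)=-\tau\big((L_\succ(y)\otimes\mathrm{id}-\mathrm{id}\otimes R(y))\theta_\succ(x)\big),$$ $$(L_\succ(y)\otimes\mathrm{id}-\mathrm{id}\otimes R_\prec(y))\theta(x)=\tau\big((\mathrm{id}\otimes R_\succ(x))\theta_\succ(y)-(L_\prec(x)\otimes\mathrm{id})\theta_\prec(y)\big).$$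 Let $(B,\cdot,\omega)$ be a quadratic perm algebra: $a(bc)=(ab)c=(ba)c$ for all $a,b,c\in B$, and $\omega$ is a nondegenerate antisymmetric bilinear form on $B$ with $\omega(ab,c)=\omega(a,bc-cb)$. Let $\nu:B\to B\otimes B$ be the linear map determined by $\omega(\nu(a),b\otimes c)=-\omega(a,bc)$, where $\omega(a_1\otimes a_2,b\otimes c)=\omega(a_1,b)\,\omega(a_2,c)$. For $s=\sum d_1\otimes d_2\in D\otimes D$ and $t=\sum b_1\otimes b_2\in B\otimes B$ put $s\bullet t=\sum\sum(d_1\otimes b_1)\otimes(d_2\otimes b_2)$. A pre-Lie bialgebra $(A,\diamond,\vartheta)$ is a pre-Lie algebra, $x\diamond(y\diamond z)-(x\diamond y)\diamond z=y\diamond(x\diamond z)-(y\diamond x)\diamond z$, with a pre-Lie coalgebra structure $\vartheta:A\to A\otimes A$, $(\mathrm{id}-\tau\otimes\mathrm{id})\big((\mathrm{id}\otimes\vartheta)\vartheta-(\vartheta\otimes\mathrm{id})\vartheta\big)=0$, such that, with $L(x)y=x\diamond y$, $R(x)y=y\diamond x$ and $\bar\vartheta=\vartheta-\tau\vartheta$,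 $$\bar\vartheta(x\diamond y)=(L(x)\otimes\mathrm{id}+\mathrm{id}\otimes L(x))\bar\vartheta(y)+(\mathrm{id}\otimes R(y))\vartheta(x)-(R(y)\otimes\mathrm{id})\tau\vartheta(x),$$ $$\vartheta(x\diamond y-y\diamond x)=(L(x)\otimes\mathrm{id}+\mathrm{id}\otimes(L-R)(x))\vartheta(y)-(L(y)\otimes\mathrm{id}+\mathrm{id}\otimes(L-R)(y))\vartheta(x).$$ An ASI (antisymmetric infinitesimal) bialgebra $(A,\ast,\Delta)$ is an associative algebra with a coassociative $\Delta:A\to A\otimes A$ (no unit or counit required) such that, with $L(x)y=x\ast y$, $R(x)y=y\ast x$, $$\Delta(x\ast y)=(R(y)\otimes\mathrm{id})\Delta(x)+(\mathrm{id}\otimes L(x))\Delta(y),$$ $$(L(x)\otimes\mathrm{id}-\mathrm{id}\otimes R(x))\Delta(y)=\tau\big((\mathrm{id}\otimes R(y)-L(y)\otimes\mathrm{id})\Delta(x)\big).$$ A Lie bialgebra $(\mathfrak g,[\cdot,\cdot],\delta)$ is a Lie algebra with $\delta:\mathfrak g\to\mathfrak g\otimes\mathfrak g$ such that $\tau\delta=-\delta$,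 $(\mathrm{id}\otimes\delta)\delta-(\tau\otimes\mathrm{id})(\mathrm{id}\otimes\delta)\delta=(\delta\otimes\mathrm{id})\delta$ and $\delta([x,y])=x\cdot\delta(y)-y\cdot\delta(x)$, where $x\cdot(u\otimes v)=[x,u]\otimes v+u\otimes[x,v]$. Then the following hold. (1) $(D,\diamond,\vartheta)$ with $x\diamond y=x\succ y-y\prec x$ and $\vartheta=\theta_\succ-\tau\theta_\prec$ is a pre-Lie bialgebra, and $(D\otimes B,[\cdot,\cdot]_1,\delta_1)$ with $$[d\otimes b,d'\otimes b']_1=(d\diamond d')\otimes bb'-(d'\diamond d)\otimes b'b,\qquad \delta_1(d\otimes b)=(\mathrm{id}-\tau)\big(\vartheta(d)\bullet\nu(b)\big)$$ is a Lie bialgebra. (2) $(D\otimes B,\ast,\Delta)$ with $$(d\otimes b)\ast(d'\otimes b')=(d\succ d')\otimes bb'+(d\prec d')\otimes b'b,\qquad \Delta(d\otimes b)=\theta_\succ(d)\bullet\nu(b)+\theta_\prec(d)\bullet\tau(\nu(b))$$ is an ASI bialgebra, and $(D\otimes B,[\cdot,\cdot]_2,\delta_2)$ with $[u,v]_2=u\ast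 v-v\ast u$ and $\delta_2=\Delta-\tau\Delta$ is a Lie bialgebra. (3) The two routes give the same Lie bialgebra: $[\cdot,\cdot]_1=[\cdot,\cdot]_2$ and $\delta_1=\delta_2$. -/

import Mathlib

open scoped TensorProduct

namespace DendBialg

noncomputable section

/-! ## Operations written as linear maps

A bilinear product on `A` is a map `A →ₗ[k] A →ₗ[k] A`; its value at `(x, y)` is `mul x y`.
Left multiplication by `x` is `mul x`, right multiplication by `x` is `mul.flip x`.
A coproduct is a map `A →ₗ[k] A ⊗[k] A`. -/

section Basic

variable {k A : Type*} [Field k] [AddCommGroup A] [Module k A]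

/-- The flip `τ (x ⊗ y) = y ⊗ x`. -/
def tau : A ⊗[k] A →ₗ[k] A ⊗[k] A :=
  (TensorProduct.comm k A A).toLinearMap

/-- The flip of the first two factors, `τ ⊗ id`, of a threefold tensor product, which is always
bracketed to the right: `x ⊗ (y ⊗ z) ↦ y ⊗ (x ⊗ z)`. -/
def tau12 : A ⊗[k] (A ⊗[k] A) →ₗ[k] A ⊗[k] (A ⊗[k] A) :=
  (TensorProduct.leftComm k A A A).toLinearMap

/-- `(f ⊗ id) g`, with values in the threefold tensor product bracketed to the right. -/
def leftIter (f g : A →ₗ[k] A ⊗[k] A) : A →ₗ[k] A ⊗[k] (A ⊗[k] A) :=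
  (TensorProduct.assoc k A A A).toLinearMap ∘ₗ f.rTensor A ∘ₗ g

/-- `(id ⊗ f) g`. -/
def rightIter (f g : A →ₗ[k] A ⊗[k] A) : A →ₗ[k] A ⊗[k] (A ⊗[k] A) :=
  f.lTensor A ∘ₗ g

end Basic

/-! ## Dendriform algebras, coalgebras and bialgebras -/

section Dendriform

variable {k D : Type*} [Field k] [AddCommGroup D] [Module k D]

/-- Dendriform algebra `(D, ≺, ≻)`. -/
structure IsDendriformAlgebra (prec succ : D →ₗ[k] D →ₗ[k] D) : Prop where
  prec_prec : ∀ x y z, prec (prec x y) z = prec x (prec y z) + prec x (succ y z)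
  succ_prec : ∀ x y z, prec (succ x y) z = succ x (prec y z)
  succ_succ : ∀ x y z, succ x (succ y z) = succ (prec x y) z + succ (succ x y) z

/-- Dendriform coalgebra `(D, θ≺, θ≻)`. -/
structure IsDendriformCoalgebra (thp ths : D →ₗ[k] D ⊗[k] D) : Prop where
  coprec_coprec : leftIter thp thp = rightIter thp thp + rightIter ths thp
  cosucc_coprec : leftIter ths thp = rightIter thp ths
  cosucc_cosucc : rightIter ths ths = leftIter thp ths + leftIter ths ths

/-- Dendriform D-bialgebra `(D, ≺, ≻, θ≺, θ≻)`. -/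
structure IsDendriformDBialgebra (prec succ : D →ₗ[k] D →ₗ[k] D)
    (thp ths : D →ₗ[k] D ⊗[k] D) : Prop where
  algebra : IsDendriformAlgebra prec succ
  coalgebra : IsDendriformCoalgebra thp ths
  compat₁ : ∀ x y, thp (prec x y + succ x y)
    = (succ x).lTensor D (thp y) + ((prec + succ).flip y).rTensor D (thp x)
  compat₂ : ∀ x y, ths (prec x y + succ x y)
    = ((prec + succ) x).lTensor D (ths y) + (prec.flip y).rTensor D (ths x)
  compat₃ : ∀ x y, thp (prec x y) + ths (prec x y)
    = (prec x).lTensor D (ths y) + (prec.flip y).rTensor D ((thp + ths) x)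
  compat₄ : ∀ x y, thp (succ x y) + ths (succ x y)
    = (succ x).lTensor D ((thp + ths) y) + (succ.flip y).rTensor D (thp x)
  compat₅ : ∀ x y,
    ((prec + succ) x).rTensor D (thp y) - (prec.flip x).lTensor D (thp y)
      = -tau ((succ y).rTensor D (ths x) - ((prec + succ).flip y).lTensor D (ths x))
  compat₆ : ∀ x y,
    (succ y).rTensor D ((thp + ths) x) - (prec.flip y).lTensor D ((thp + ths) x)
      = tau ((succ.flip x).lTensor D (ths y) - (prec x).rTensor D (thp y))

/-- The product `x ⋄ y = x ≻ y - y ≺ x` of the induced pre-Lie algebra. -/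
def preLieMul (prec succ : D →ₗ[k] D →ₗ[k] D) : D →ₗ[k] D →ₗ[k] D :=
  succ - prec.flip

/-- The coproduct `ϑ = θ≻ - τ θ≺` of the induced pre-Lie coalgebra. -/
def preLieComul (thp ths : D →ₗ[k] D ⊗[k] D) : D →ₗ[k] D ⊗[k] D :=
  ths - tau ∘ₗ thp

end Dendriform

/-! ## Pre-Lie bialgebras, ASI bialgebras and Lie bialgebras -/

section Bialgebras

variable {k A : Type*} [Field k] [AddCommGroup A] [Module k A]

/-- (Left) pre-Lie algebra `(A, ⋄)`. -/
def IsPreLieAlgebra (dia : A →ₗ[k] A →ₗ[k] A) : Prop :=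
  ∀ x y z, dia x (dia y z) - dia (dia x y) z = dia y (dia x z) - dia (dia y x) z

/-- Pre-Lie coalgebra `(A, ϑ)`. -/
def IsPreLieCoalgebra (vth : A →ₗ[k] A ⊗[k] A) : Prop :=
  rightIter vth vth - tau12 ∘ₗ rightIter vth vth = leftIter vth vth - tau12 ∘ₗ leftIter vth vth

/-- Pre-Lie bialgebra `(A, ⋄, ϑ)`. -/
structure IsPreLieBialgebra (dia : A →ₗ[k] A →ₗ[k] A) (vth : A →ₗ[k] A ⊗[k] A) : Prop where
  algebra : IsPreLieAlgebra dia
  coalgebra : IsPreLieCoalgebra vth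
  compat₁ : ∀ x y,
    (vth - tau ∘ₗ vth) (dia x y)
      - (dia x).rTensor A ((vth - tau ∘ₗ vth) y) - (dia x).lTensor A ((vth - tau ∘ₗ vth) y)
      - (dia.flip y).lTensor A (vth x) + (dia.flip y).rTensor A (tau (vth x)) = 0
  compat₂ : ∀ x y,
    vth (dia x y - dia y x)
      - (dia.flip y - dia y).lTensor A (vth x) - (dia x - dia.flip x).lTensor A (vth y)
      - (dia x).rTensor A (vth y) + (dia y).rTensor A (vth x) = 0

/-- Antisymmetric infinitesimal (ASI) bialgebra `(A, ∗, Δ)`. No unit or counit is asked for. -/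
structure IsASIBialgebra (mul : A →ₗ[k] A →ₗ[k] A) (Del : A →ₗ[k] A ⊗[k] A) : Prop where
  assoc : ∀ x y z, mul (mul x y) z = mul x (mul y z)
  coassoc : leftIter Del Del = rightIter Del Del
  compat₁ : ∀ x y, Del (mul x y)
    = (mul.flip y).rTensor A (Del x) + (mul x).lTensor A (Del y)
  compat₂ : ∀ x y,
    (mul x).rTensor A (Del y) - (mul.flip x).lTensor A (Del y)
      = tau ((mul.flip y).lTensor A (Del x) - (mul y).rTensor A (Del x))

/-- `br` is a Lie bracket on the vector space `A`. -/
structure IsLieBracket (br : A →ₗ[k] A →ₗ[k] A) : Prop where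
  self : ∀ x, br x x = 0
  jacobi : ∀ x y z, br x (br y z) = br (br x y) z + br y (br x z)

/-- The Lie ring in the sense of Mathlib given by a Lie bracket. -/
@[reducible] def IsLieBracket.lieRing {br : A →ₗ[k] A →ₗ[k] A} (h : IsLieBracket br) :
    LieRing A :=
  { (inferInstance : AddCommGroup A) with
    bracket := fun x y => br x y
    add_lie := fun x y z => by simp
    lie_add := fun x y z => by simp
    lie_self := h.self
    leibniz_lie := h.jacobi }

/-- The Lie algebra in the sense of Mathlib given by a Lie bracket. -/
@[reducible] def IsLieBracket.lieAlgebra {br : A →ₗ[k] A →ₗ[k] A} (h : IsLieBracket br) :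
    letI := h.lieRing
    LieAlgebra k A :=
  letI := h.lieRing
  { (inferInstance : Module k A) with
    lie_smul := fun t x y => (br x).map_smul t y }

/-- Lie coalgebra `(A, δ)`. -/
structure IsLieCoalgebra (del : A →ₗ[k] A ⊗[k] A) : Prop where
  antisymm : tau ∘ₗ del = -del
  cojacobi : rightIter del del - tau12 ∘ₗ rightIter del del = leftIter del del

/-- Lie bialgebra `(A, [·,·], δ)`. -/
structure IsLieBialgebra (br : A →ₗ[k] A →ₗ[k] A) (del : A →ₗ[k] A ⊗[k] A) : Prop where
  algebra : IsLieBracket br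
  coalgebra : IsLieCoalgebra del
  compat : ∀ x y, del (br x y)
    = ((br x).rTensor A (del y) + (br x).lTensor A (del y))
      - ((br y).rTensor A (del x) + (br y).lTensor A (del x))

/-- The commutator `[x, y] = x ∗ y - y ∗ x`. -/
def commBracket (mul : A →ₗ[k] A →ₗ[k] A) : A →ₗ[k] A →ₗ[k] A :=
  mul - mul.flip

/-- The cocommutator `δ = Δ - τ Δ`. -/
def cocommutator (Del : A →ₗ[k] A ⊗[k] A) : A →ₗ[k] A ⊗[k] A :=
  Del - tau ∘ₗ Del

end Bialgebras

/-! ## Quadratic perm algebras and the coproduct given by the form -/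

section Perm

variable {k B : Type*} [Field k] [AddCommGroup B] [Module k B]

/-- Perm algebra `(B, ·)`. -/
structure IsPermAlgebra (mul : B →ₗ[k] B →ₗ[k] B) : Prop where
  assoc : ∀ a b c, mul a (mul b c) = mul (mul a b) c
  left_comm : ∀ a b c, mul (mul a b) c = mul (mul b a) c

/-- Quadratic perm algebra `(B, ·, ω)`. -/
structure IsQuadraticPermAlgebra (mul : B →ₗ[k] B →ₗ[k] B) (om : LinearMap.BilinForm k B) :
    Prop where
  perm : IsPermAlgebra mul
  antisymm : ∀ a b, om a b = -om b a
  invariant : ∀ a b c, om (mul a b) c = om a (mul b c - mul c b)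
  nondegenerate : om.Nondegenerate

variable [FiniteDimensional k B]

/-- The pairing `(a ⊗ b, c ⊗ d) ↦ ω(a, c) ω(b, d)` on `B ⊗ B`, as an isomorphism of `B ⊗ B` with
its dual. -/
def tensorForm (om : LinearMap.BilinForm k B) (h : om.Nondegenerate) :
    (B ⊗[k] B) ≃ₗ[k] Module.Dual k (B ⊗[k] B) :=
  TensorProduct.congr (om.toDual h) (om.toDual h) ≪≫ₗ TensorProduct.dualDistribEquiv k B B

theorem tensorForm_tmul (om : LinearMap.BilinForm k B) (h : om.Nondegenerate) (a b c d : B) :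
    tensorForm om h (a ⊗ₜ b) (c ⊗ₜ d) = om a c * om b d := rfl

/-- The coproduct `ν` on `B` determined by `ω(ν a, b ⊗ c) = -ω(a, b c)`. -/
def formComul (mul : B →ₗ[k] B →ₗ[k] B) (om : LinearMap.BilinForm k B) (h : om.Nondegenerate) :
    B →ₗ[k] B ⊗[k] B :=
  (tensorForm om h).symm.toLinearMap ∘ₗ (-((TensorProduct.lift mul).dualMap ∘ₗ om))

/-- `formComul` is the only linear map with its defining property. -/
theorem eq_formComul_iff (mul : B →ₗ[k] B →ₗ[k] B) (om : LinearMap.BilinForm k B)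
    (h : om.Nondegenerate) (nu : B →ₗ[k] B ⊗[k] B) :
    nu = formComul mul om h ↔
      ∀ a b c, tensorForm om h (nu a) (b ⊗ₜ c) = -om a (mul b c) := by
  constructor
  · rintro rfl a b c
    simp [formComul]
  · intro hnu
    ext1 a
    apply (tensorForm om h).injective
    apply TensorProduct.ext'
    intro b c
    rw [hnu]
    simp [formComul]

end Perm

/-! ## Structures on `D ⊗ B` -/

section Tensor

variable {k D B : Type*} [Field k] [AddCommGroup D] [Module k D] [AddCommGroup B] [Module k B]

/-- The map `d ⊗ b ↦ f(d) • g(b)`, where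
`(d₁ ⊗ d₂) • (b₁ ⊗ b₂) = (d₁ ⊗ b₁) ⊗ (d₂ ⊗ b₂)`. -/
def bullet (f : D →ₗ[k] D ⊗[k] D) (g : B →ₗ[k] B ⊗[k] B) :
    D ⊗[k] B →ₗ[k] (D ⊗[k] B) ⊗[k] (D ⊗[k] B) :=
  (TensorProduct.tensorTensorTensorComm k D D B B).toLinearMap ∘ₗ TensorProduct.map f g

/-- `(d ⊗ b) ∗ (d' ⊗ b') = (d ≻ d') ⊗ (b b') + (d ≺ d') ⊗ (b' b)`. -/
def tensorAssocMul (prec succ : D →ₗ[k] D →ₗ[k] D) (mul : B →ₗ[k] B →ₗ[k] B) :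
    D ⊗[k] B →ₗ[k] D ⊗[k] B →ₗ[k] D ⊗[k] B :=
  TensorProduct.map₂ succ mul + TensorProduct.map₂ prec mul.flip

/-- `Δ(d ⊗ b) = θ≻(d) • ν(b) + θ≺(d) • τ(ν(b))`. -/
def tensorAssocComul (thp ths : D →ₗ[k] D ⊗[k] D) (nu : B →ₗ[k] B ⊗[k] B) :
    D ⊗[k] B →ₗ[k] (D ⊗[k] B) ⊗[k] (D ⊗[k] B) :=
  bullet ths nu + bullet thp (tau ∘ₗ nu)

/-- `[d ⊗ b, d' ⊗ b'] = (d ⋄ d') ⊗ (b b') - (d' ⋄ d) ⊗ (b' b)`. -/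
def tensorLieBracket (dia : D →ₗ[k] D →ₗ[k] D) (mul : B →ₗ[k] B →ₗ[k] B) :
    D ⊗[k] B →ₗ[k] D ⊗[k] B →ₗ[k] D ⊗[k] B :=
  TensorProduct.map₂ dia mul - TensorProduct.map₂ dia.flip mul.flip

/-- `δ(d ⊗ b) = (id - τ)(ϑ(d) • ν(b))`. -/
def tensorLieCobracket (vth : D →ₗ[k] D ⊗[k] D) (nu : B →ₗ[k] B ⊗[k] B) :
    D ⊗[k] B →ₗ[k] (D ⊗[k] B) ⊗[k] (D ⊗[k] B) :=
  bullet vth nu - tau ∘ₗ bullet vth nu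

end Tensor

end

end DendBialg

open DendBialg

/-!
All claims about coproducts are reduced to claims about products. On a finite-dimensional space a
coproduct is the same as a product on the dual space (`dualMul`), and coassociativity, the pre-Lie
and Lie coalgebra axioms and the dendriform coalgebra axioms become the corresponding axioms for
products. Since the form identifies the coproduct `ν` with the product of `B`
(`IsQuadraticPermAlgebra.dualMul_formComul`), the coproduct `Δ` on `D ⊗ B` is dual to the product
`∗` built from `D*` and `B` (`dualMul_tensorAssocComul`), so one computation
(`tensorAssocMul_assoc`) gives both associativity and coassociativity.

The compatibility conditions of the ASI bialgebra (`IsDendriformDBialgebra.isASIBialgebra`) are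
equations in `(D ⊗ B) ⊗ (D ⊗ B)`. They are tested by contracting the two factors `B` with
`ω(p, ·)` and `ω(q, ·)`. Because left multiplication is self-adjoint for `ω`
(`IsQuadraticPermAlgebra.form_mul_left`) and right multiplication has the adjoint `p ↦ a p - p a`,
what is left are equations in `D ⊗ D` with coefficients pairings of `a, b, p, q`. These
coefficients are combinations of three of them, and collecting terms leaves linear combinations of
the compatibility conditions of `D`.

The commutator and the cocommutator of an ASI bialgebra form a Lie bialgebra
(`IsASIBialgebra.isLieBialgebra`). The bracket and the cobracket obtained from the pre-Lie bialgebra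
are these same maps (`tensorLieBracket_preLieMul`, `tensorLieCobracket_preLieComul`), so the Lie
bialgebra of the pre-Lie route needs no separate verification.
-/

open scoped TensorProduct

namespace DendBialg

noncomputable section

/-! ### The flip -/

section
variable {k A : Type*} [Field k] [AddCommGroup A] [Module k A]

theorem tau_tau (t : A ⊗[k] A) : tau (tau t) = t := by
  simp [tau]

theorem tau_rTensor (f : A →ₗ[k] A) (t : A ⊗[k] A) : tau (f.rTensor A t) = f.lTensor A (tau t) :=
  LinearMap.congr_fun (f := tau ∘ₗ f.rTensor A) (g := f.lTensor A ∘ₗ tau)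
    (TensorProduct.ext' fun x y => by simp [tau]) t

theorem tau_lTensor (f : A →ₗ[k] A) (t : A ⊗[k] A) : tau (f.lTensor A t) = f.rTensor A (tau t) := by
  rw [← tau_tau t, ← tau_rTensor, tau_tau, tau_tau]

end

/-! ### Coproducts as products on the dual space -/

section
variable {k A : Type*} [Field k] [AddCommGroup A] [Module k A]

/-- Bilinear products on `M`. The type is spelled through the `AddCommGroup` structure of `M`, so
that for `M` a dual space it has the form that the predicates on products expect. -/
abbrev BilinearOp (k M : Type*) [Field k] [AddCommGroup M] [Module k M] := M →ₗ[k] M →ₗ[k] M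

/-- The product on the dual space that is dual to a coproduct `f`: `(ξ η)(x) = (ξ ⊗ η)(f x)`. -/
def dualMul (f : A →ₗ[k] A ⊗[k] A) : BilinearOp k (Module.Dual k A) :=
  TensorProduct.curry (f.dualMap ∘ₗ TensorProduct.dualDistrib k A A)

theorem dualMul_apply (f : A →ₗ[k] A ⊗[k] A) (ξ η : Module.Dual k A) (x : A) :
    dualMul f ξ η x = TensorProduct.dualDistrib k A A (ξ ⊗ₜ η) (f x) := rfl

theorem dualDistrib_tau (ξ η : Module.Dual k A) (t : A ⊗[k] A) :
    TensorProduct.dualDistrib k A A (ξ ⊗ₜ η) (tau t)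
      = TensorProduct.dualDistrib k A A (η ⊗ₜ ξ) t := by
  induction t with
  | zero => simp
  | tmul x y => simp [tau, mul_comm]
  | add x y hx hy => simp_all

theorem dualMul_tau_comp (f : A →ₗ[k] A ⊗[k] A) : dualMul (tau ∘ₗ f) = (dualMul f).flip := by
  ext ξ η x
  simp [dualMul_apply, dualDistrib_tau]

/-- The functional `ξ ⊗ η ⊗ ζ` on the threefold tensor product. -/
def pairThree (ξ η ζ : Module.Dual k A) : Module.Dual k (A ⊗[k] (A ⊗[k] A)) :=
  TensorProduct.dualDistrib k A (A ⊗[k] A) (ξ ⊗ₜ TensorProduct.dualDistrib k A A (η ⊗ₜ ζ))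

theorem pairThree_leftIter (f g : A →ₗ[k] A ⊗[k] A) (ξ η ζ : Module.Dual k A) (x : A) :
    pairThree ξ η ζ (leftIter f g x) = dualMul g (dualMul f ξ η) ζ x := by
  simp only [leftIter, LinearMap.comp_apply, dualMul_apply g]
  induction g x with
  | zero => simp
  | tmul u v =>
    simp only [LinearMap.rTensor_tmul, TensorProduct.dualDistrib_apply, dualMul_apply]
    induction f u with
    | zero => simp
    | tmul x y => simp [pairThree, mul_assoc]
    | add x y hx hy => simp only [TensorProduct.add_tmul, map_add, hx, hy, add_mul]
  | add x y hx hy => simp only [map_add, hx, hy]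

theorem pairThree_rightIter (f g : A →ₗ[k] A ⊗[k] A) (ξ η ζ : Module.Dual k A) (x : A) :
    pairThree ξ η ζ (rightIter f g x) = dualMul g ξ (dualMul f η ζ) x := by
  simp only [rightIter, LinearMap.comp_apply, dualMul_apply g]
  induction g x with
  | zero => simp
  | tmul u v => simp [pairThree, dualMul_apply]
  | add x y hx hy => simp only [map_add, hx, hy]

theorem pairThree_tau12 (ξ η ζ : Module.Dual k A) (t : A ⊗[k] (A ⊗[k] A)) :
    pairThree ξ η ζ (tau12 t) = pairThree η ξ ζ t := by
  induction t with
  | zero => simp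
  | tmul x u =>
    induction u with
    | zero => simp
    | tmul y z => simp [pairThree, tau12, mul_left_comm]
    | add x y hx hy => simp_all [TensorProduct.tmul_add]
  | add x y hx hy => simp_all

/-- A dendriform coalgebra is a dendriform algebra on the dual space. -/
theorem IsDendriformCoalgebra.dual {thp ths : A →ₗ[k] A ⊗[k] A}
    (h : IsDendriformCoalgebra thp ths) :
    IsDendriformAlgebra (dualMul thp) (dualMul ths) where
  prec_prec ξ η ζ := by
    ext x
    rw [← pairThree_leftIter, h.coprec_coprec, LinearMap.add_apply, map_add, pairThree_rightIter,
      pairThree_rightIter]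
    rfl
  succ_prec ξ η ζ := by
    ext x
    rw [← pairThree_leftIter, ← pairThree_rightIter, h.cosucc_coprec]
  succ_succ ξ η ζ := by
    ext x
    simp only [LinearMap.add_apply, ← pairThree_leftIter, ← pairThree_rightIter, ← map_add,
      h.cosucc_cosucc]

/-- Functionals of the form `ξ ⊗ η` separate the points of a tensor product of finite-dimensional
spaces, since they span its dual. -/
theorem ext_dualDistrib {M N : Type*} [AddCommGroup M] [Module k M] [FiniteDimensional k M]
    [AddCommGroup N] [Module k N] [FiniteDimensional k N] {s t : M ⊗[k] N}
    (h : ∀ ξ η, TensorProduct.dualDistrib k M N (ξ ⊗ₜ η) s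
      = TensorProduct.dualDistrib k M N (ξ ⊗ₜ η) t) : s = t := by
  rw [← sub_eq_zero, ← Module.forall_dual_apply_eq_zero_iff k]
  intro φ
  obtain ⟨w, rfl⟩ := (TensorProduct.dualDistribEquiv k M N).surjective φ
  change TensorProduct.dualDistrib k M N w (s - t) = 0
  induction w with
  | zero => simp
  | tmul ξ η => rw [map_sub, h, sub_self]
  | add x y hx hy => rw [map_add, LinearMap.add_apply, hx, hy, add_zero]

variable [FiniteDimensional k A]

theorem ext_pairThree {s t : A ⊗[k] (A ⊗[k] A)}
    (h : ∀ ξ η ζ, pairThree ξ η ζ s = pairThree ξ η ζ t) : s = t := by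
  refine ext_dualDistrib fun ξ φ => ?_
  obtain ⟨w, rfl⟩ := (TensorProduct.dualDistribEquiv k A A).surjective φ
  induction w with
  | zero => simp
  | tmul η ζ => exact h ξ η ζ
  | add x y hx hy => simp only [map_add, TensorProduct.tmul_add, LinearMap.add_apply, hx, hy]

theorem IsPreLieCoalgebra.of_dual {vth : A →ₗ[k] A ⊗[k] A} (h : IsPreLieAlgebra (dualMul vth)) :
    IsPreLieCoalgebra vth := by
  refine LinearMap.ext fun x => ext_pairThree fun ξ η ζ => ?_
  simp only [LinearMap.sub_apply, LinearMap.comp_apply, map_sub, pairThree_tau12,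
    pairThree_leftIter, pairThree_rightIter]
  have := LinearMap.congr_fun (h ξ η ζ) x
  simp only [LinearMap.sub_apply] at this
  linear_combination this

theorem leftIter_eq_rightIter_of_dual {Del : A →ₗ[k] A ⊗[k] A}
    (h : ∀ ξ η ζ, dualMul Del (dualMul Del ξ η) ζ = dualMul Del ξ (dualMul Del η ζ)) :
    leftIter Del Del = rightIter Del Del := by
  refine LinearMap.ext fun x => ext_pairThree fun ξ η ζ => ?_
  rw [pairThree_leftIter, pairThree_rightIter, h]

theorem IsLieCoalgebra.of_dual {del : A →ₗ[k] A ⊗[k] A} (h : IsLieBracket (dualMul del)) :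
    IsLieCoalgebra del where
  antisymm := by
    refine LinearMap.ext fun x => ext_dualDistrib fun ξ η => ?_
    have := LinearMap.congr_fun (h.self (ξ + η)) x
    simp only [map_add, LinearMap.add_apply, h.self, LinearMap.zero_apply, dualMul_apply] at this
    simp only [LinearMap.comp_apply, LinearMap.neg_apply, map_neg, dualDistrib_tau]
    linear_combination this
  cojacobi := by
    refine LinearMap.ext fun x => ext_pairThree fun ξ η ζ => ?_
    simp only [LinearMap.sub_apply, LinearMap.comp_apply, map_sub, pairThree_tau12,
      pairThree_leftIter, pairThree_rightIter]
    have := LinearMap.congr_fun (h.jacobi ξ η ζ) x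
    simp only [LinearMap.add_apply] at this
    linear_combination this

end

/-! ### Pre-Lie and Lie structures from dendriform and associative ones -/

section
variable {k A : Type*} [Field k] [AddCommGroup A] [Module k A]

theorem commBracket_apply (mul : A →ₗ[k] A →ₗ[k] A) (x y : A) :
    commBracket mul x y = mul x y - mul y x := rfl

theorem preLieMul_apply (prec succ : A →ₗ[k] A →ₗ[k] A) (x y : A) :
    preLieMul prec succ x y = succ x y - prec y x := rfl

theorem IsLieBracket.commBracket {mul : A →ₗ[k] A →ₗ[k] A}
    (h : ∀ x y z, mul (mul x y) z = mul x (mul y z)) : IsLieBracket (commBracket mul) where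
  self x := by simp [DendBialg.commBracket]
  jacobi x y z := by
    simp only [DendBialg.commBracket, LinearMap.sub_apply, LinearMap.flip_apply, map_sub, h]
    abel

theorem IsDendriformAlgebra.isPreLieAlgebra {prec succ : A →ₗ[k] A →ₗ[k] A}
    (h : IsDendriformAlgebra prec succ) : IsPreLieAlgebra (preLieMul prec succ) := fun x y z => by
  simp only [preLieMul, LinearMap.sub_apply, LinearMap.flip_apply, map_sub, h.succ_succ,
    h.prec_prec, h.succ_prec]
  abel

theorem dualMul_cocommutator (Del : A →ₗ[k] A ⊗[k] A) :
    dualMul (cocommutator Del) = commBracket (dualMul Del) := by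
  ext ξ η x
  rw [commBracket_apply, LinearMap.sub_apply]
  simp only [dualMul_apply, cocommutator, LinearMap.sub_apply, LinearMap.comp_apply, map_sub,
    dualDistrib_tau]

theorem dualMul_preLieComul (thp ths : A →ₗ[k] A ⊗[k] A) :
    dualMul (preLieComul thp ths) = preLieMul (dualMul thp) (dualMul ths) := by
  ext ξ η x
  rw [preLieMul_apply, LinearMap.sub_apply]
  simp only [dualMul_apply, preLieComul, LinearMap.sub_apply, LinearMap.comp_apply, map_sub,
    dualDistrib_tau]

/-- The commutator and the cocommutator of an ASI bialgebra form a Lie bialgebra. -/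
theorem IsASIBialgebra.isLieBialgebra [FiniteDimensional k A] {mul : A →ₗ[k] A →ₗ[k] A}
    {Del : A →ₗ[k] A ⊗[k] A} (h : IsASIBialgebra mul Del) :
    IsLieBialgebra (commBracket mul) (cocommutator Del) where
  algebra := .commBracket h.assoc
  coalgebra := by
    refine .of_dual ?_
    rw [dualMul_cocommutator]
    refine .commBracket fun ξ η ζ => ?_
    ext x
    rw [← pairThree_leftIter, ← pairThree_rightIter, h.coassoc]
  compat x y := by
    have h1 := h.compat₁ x y
    have h2 := h.compat₁ y x
    have h3 := congrArg tau h1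
    have h4 := congrArg tau h2
    have h5 := h.compat₂ x y
    have h6 := h.compat₂ y x
    simp only [cocommutator, commBracket, LinearMap.sub_apply, LinearMap.comp_apply,
      LinearMap.flip_apply, LinearMap.rTensor_sub, LinearMap.lTensor_sub, map_sub, map_add,
      tau_rTensor, tau_lTensor] at *
    linear_combination (norm := module) h1 - h2 - h3 + h4 - h5 + h6

theorem preLieMul_left (prec succ : A →ₗ[k] A →ₗ[k] A) (x : A) :
    preLieMul prec succ x = succ x - prec.flip x := rfl

theorem preLieMul_flip (prec succ : A →ₗ[k] A →ₗ[k] A) (x : A) :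
    (preLieMul prec succ).flip x = succ.flip x - prec x := rfl

theorem add_flip_apply (f g : A →ₗ[k] A →ₗ[k] A) (x : A) :
    (f + g).flip x = f.flip x + g.flip x := rfl

/-- A dendriform D-bialgebra induces a pre-Lie bialgebra. Each compatibility condition is a linear
combination of those of the D-bialgebra and of their images under the flip. -/
theorem IsDendriformDBialgebra.isPreLieBialgebra [FiniteDimensional k A]
    {prec succ : A →ₗ[k] A →ₗ[k] A} {thp ths : A →ₗ[k] A ⊗[k] A}
    (h : IsDendriformDBialgebra prec succ thp ths) :
    IsPreLieBialgebra (preLieMul prec succ) (preLieComul thp ths) where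
  algebra := h.algebra.isPreLieAlgebra
  coalgebra := .of_dual <| by
    rw [dualMul_preLieComul]
    exact h.coalgebra.dual.isPreLieAlgebra
  compat₁ x y := by
    have h1 := h.compat₁ x y
    have h2 := h.compat₂ x y
    have h3 := h.compat₃ x y
    have h3' := h.compat₃ y x
    have h5 := h.compat₅ x y
    have h5' := h.compat₅ y x
    have h6 := h.compat₆ x y
    have t1 := congrArg tau h1
    have t2 := congrArg tau h2
    have t3 := congrArg tau h3
    have t3' := congrArg tau h3'
    have t5 := congrArg tau h5
    have t5' := congrArg tau h5'
    have t6 := congrArg tau h6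
    simp only [preLieComul, preLieMul_left, preLieMul_flip, add_flip_apply,
      LinearMap.sub_apply, LinearMap.add_apply, LinearMap.comp_apply, LinearMap.flip_apply,
      LinearMap.rTensor_sub, LinearMap.lTensor_sub, LinearMap.rTensor_add, LinearMap.lTensor_add,
      map_sub, map_add, map_neg, tau_rTensor, tau_lTensor, tau_tau] at *
    linear_combination (norm := module) h1 - t1 + h2 - t2 - h3 + t3 - h5 + t5 - h6 + t6
      - h3' + t3' + h5' - t5'
  compat₂ x y := by
    have h2 := h.compat₂ x y
    have h2' := h.compat₂ y x
    have t1 := congrArg tau (h.compat₁ x y)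
    have t1' := congrArg tau (h.compat₁ y x)
    have t5 := congrArg tau (h.compat₅ x y)
    have t5' := congrArg tau (h.compat₅ y x)
    simp only [preLieComul, preLieMul_left, preLieMul_flip, add_flip_apply,
      LinearMap.sub_apply, LinearMap.add_apply, LinearMap.comp_apply, LinearMap.flip_apply,
      LinearMap.rTensor_sub, LinearMap.lTensor_sub, LinearMap.rTensor_add, LinearMap.lTensor_add,
      map_sub, map_add, map_neg, tau_rTensor, tau_lTensor, tau_tau] at *
    linear_combination (norm := module) h2 - h2' - t1 + t1' + t5 - t5'

end

/-! ### Quadratic perm algebras -/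

section
variable {k B : Type*} [Field k] [AddCommGroup B] [Module k B]

theorem IsPermAlgebra.mul_left_comm {mul : B →ₗ[k] B →ₗ[k] B} (h : IsPermAlgebra mul) (a b c : B) :
    mul a (mul b c) = mul b (mul a c) := by
  rw [h.assoc, h.left_comm, ← h.assoc]

variable {mul : B →ₗ[k] B →ₗ[k] B} {om : LinearMap.BilinForm k B}

/-- Left multiplications are self-adjoint for `ω`: apply invariance to `(b a, c)` and `(c a, b)` and
eliminate `ω(c a, b)`. -/
theorem IsQuadraticPermAlgebra.form_mul_left (h : IsQuadraticPermAlgebra mul om) (a b c : B) :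
    om (mul a b) c = om b (mul a c) := by
  have h₁ := h.invariant b a c
  have h₂ := h.invariant c a b
  rw [map_sub] at h₁ h₂
  linear_combination h₁ + h₂ + h.antisymm c (mul a b) - h.antisymm c (mul b a)
    - h.antisymm b (mul c a)

theorem IsQuadraticPermAlgebra.comp_mul (h : IsQuadraticPermAlgebra mul om) (a p : B) :
    om p ∘ₗ mul a = om (mul a p) :=
  LinearMap.ext fun b => (h.form_mul_left a p b).symm

/-- The adjoint of right multiplication by `a` is `p ↦ a p - p a`. -/
theorem IsQuadraticPermAlgebra.comp_mul_flip (h : IsQuadraticPermAlgebra mul om) (a p : B) :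
    om p ∘ₗ mul.flip a = om (mul a p - mul p a) := by
  ext b
  simp only [LinearMap.comp_apply, LinearMap.flip_apply, map_sub, LinearMap.sub_apply]
  rw [h.antisymm p, h.invariant, map_sub, h.antisymm b, h.antisymm b]
  ring

/-! ### Four-fold scalars of a quadratic perm algebra

Every product of four elements paired by `ω` is of the form `ω(z, x y w)`, which is symmetric in
`x, y`, antisymmetric in `z, w`, and satisfies a three-term relation. Once `a` is singled out, only
the three scalars `ω(a, x y w)` remain. -/

theorem IsQuadraticPermAlgebra.form_mul_mul (h : IsQuadraticPermAlgebra mul om) (x z y w : B) :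
    om (mul x z) (mul y w) = om z (mul x (mul y w)) := h.form_mul_left ..

theorem IsQuadraticPermAlgebra.form_mul_mul_left (h : IsQuadraticPermAlgebra mul om) (x y z w : B) :
    om (mul (mul x y) z) w = om z (mul x (mul y w)) := by
  rw [h.form_mul_left, h.perm.assoc]

theorem IsQuadraticPermAlgebra.form_mul_mul_right (h : IsQuadraticPermAlgebra mul om) (x y z w : B) :
    om (mul x (mul y z)) w = om z (mul x (mul y w)) := by
  rw [h.form_mul_left, h.form_mul_left, h.perm.mul_left_comm]

theorem IsQuadraticPermAlgebra.form_swap (h : IsQuadraticPermAlgebra mul om) (a x y z : B) :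
    om z (mul x (mul y a)) = -om a (mul x (mul y z)) := by
  rw [h.antisymm, h.form_mul_mul_right]

/-- The three-term relation, solved for the pairing that does not start with `a`. -/
theorem IsQuadraticPermAlgebra.form_cyc (h : IsQuadraticPermAlgebra mul om) (a x z w : B) :
    om z (mul a (mul x w)) = om a (mul x (mul z w)) - om a (mul x (mul w z)) := by
  rw [← h.form_mul_mul, h.invariant, map_sub, h.perm.mul_left_comm z, h.perm.assoc x w z]

theorem IsQuadraticPermAlgebra.form_cyc' (h : IsQuadraticPermAlgebra mul om) (a x z w : B) :
    om z (mul x (mul a w)) = om a (mul x (mul z w)) - om a (mul x (mul w z)) := by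
  rw [h.perm.mul_left_comm, h.form_cyc]

/-- Under the identification `p ↦ ω(p, ·)` of `B` with its dual, the product dual to `ν` is the
product of `B`. -/
theorem IsQuadraticPermAlgebra.dualMul_formComul [FiniteDimensional k B]
    (h : IsQuadraticPermAlgebra mul om) (p q : B) :
    dualMul (formComul mul om h.nondegenerate) (om p) (om q) = om (mul p q) := by
  ext b
  have key := (eq_formComul_iff mul om h.nondegenerate _).1 rfl b p q
  rw [h.antisymm, ← key, dualMul_apply]
  induction formComul mul om h.nondegenerate b with
  | zero => simp
  | tmul x y =>
    rw [tensorForm_tmul, h.antisymm x, h.antisymm y, TensorProduct.dualDistrib_apply]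
    ring
  | add x y hx hy => simp only [map_add, LinearMap.add_apply, hx, hy]

end

/-! ### Operations on `D ⊗ B` and contraction to `D ⊗ D` -/

section
variable {k D B : Type*} [Field k] [AddCommGroup D] [Module k D] [AddCommGroup B] [Module k B]

/-- Contraction of the two factors `B` of `(D ⊗ B) ⊗ (D ⊗ B)` with functionals `f` and `g`. -/
def slice (f g : Module.Dual k B) : (D ⊗[k] B) ⊗[k] (D ⊗[k] B) →ₗ[k] D ⊗[k] D :=
  TensorProduct.map ((TensorProduct.rid k D).toLinearMap ∘ₗ f.lTensor D)
    ((TensorProduct.rid k D).toLinearMap ∘ₗ g.lTensor D)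

theorem slice_tau (f g : Module.Dual k B) (u : (D ⊗[k] B) ⊗[k] (D ⊗[k] B)) :
    slice f g (tau u) = tau (slice g f u) := by
  induction u with
  | zero => simp
  | tmul x y => simp [slice, tau]
  | add x y hx hy => simp only [map_add, hx, hy]

theorem slice_bullet (f g : Module.Dual k B) (θ : D →ₗ[k] D ⊗[k] D) (ν : B →ₗ[k] B ⊗[k] B)
    (d : D) (b : B) : slice f g (bullet θ ν (d ⊗ₜ b)) = dualMul ν f g b • θ d := by
  simp only [bullet, LinearMap.comp_apply, TensorProduct.map_tmul, dualMul_apply]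
  induction θ d with
  | zero => simp
  | add x y hx hy => simp only [TensorProduct.add_tmul, map_add, hx, hy, smul_add]
  | tmul d₁ d₂ =>
    induction ν b with
    | zero => simp
    | add x y hx hy => simp only [TensorProduct.tmul_add, map_add, hx, hy, add_smul]
    | tmul b₁ b₂ => simp [slice, TensorProduct.smul_tmul', smul_smul, mul_comm]

theorem slice_rTensor_map (f g : Module.Dual k B) (P : D →ₗ[k] D) (Q : B →ₗ[k] B)
    (u : (D ⊗[k] B) ⊗[k] (D ⊗[k] B)) :
    slice f g ((TensorProduct.map P Q).rTensor (D ⊗[k] B) u)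
      = P.rTensor D (slice (f ∘ₗ Q) g u) := by
  refine LinearMap.congr_fun (f := slice f g ∘ₗ (TensorProduct.map P Q).rTensor (D ⊗[k] B))
    (g := P.rTensor D ∘ₗ slice (f ∘ₗ Q) g) ?_ u
  ext
  simp [slice]

theorem slice_lTensor_map (f g : Module.Dual k B) (P : D →ₗ[k] D) (Q : B →ₗ[k] B)
    (u : (D ⊗[k] B) ⊗[k] (D ⊗[k] B)) :
    slice f g ((TensorProduct.map P Q).lTensor (D ⊗[k] B) u)
      = P.lTensor D (slice f (g ∘ₗ Q) u) := by
  refine LinearMap.congr_fun (f := slice f g ∘ₗ (TensorProduct.map P Q).lTensor (D ⊗[k] B))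
    (g := P.lTensor D ∘ₗ slice f (g ∘ₗ Q)) ?_ u
  ext
  simp [slice]

theorem dualDistrib_slice (ξ η : Module.Dual k D) (f g : Module.Dual k B)
    (u : (D ⊗[k] B) ⊗[k] (D ⊗[k] B)) :
    TensorProduct.dualDistrib k D D (ξ ⊗ₜ η) (slice f g u)
      = TensorProduct.dualDistrib k (D ⊗[k] B) (D ⊗[k] B)
        (TensorProduct.dualDistrib k D B (ξ ⊗ₜ f) ⊗ₜ TensorProduct.dualDistrib k D B (η ⊗ₜ g)) u := by
  refine LinearMap.congr_fun (f := TensorProduct.dualDistrib k D D (ξ ⊗ₜ η) ∘ₗ slice f g) ?_ u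
  ext
  simp [slice]
  ring

theorem tensorAssocMul_tmul_left (prec succ : D →ₗ[k] D →ₗ[k] D) (mul : B →ₗ[k] B →ₗ[k] B)
    (d : D) (b : B) : tensorAssocMul prec succ mul (d ⊗ₜ b)
      = TensorProduct.map (succ d) (mul b) + TensorProduct.map (prec d) (mul.flip b) := by
  ext; simp [tensorAssocMul]

theorem tensorAssocMul_flip_tmul (prec succ : D →ₗ[k] D →ₗ[k] D) (mul : B →ₗ[k] B →ₗ[k] B)
    (d : D) (b : B) : (tensorAssocMul prec succ mul).flip (d ⊗ₜ b)
      = TensorProduct.map (succ.flip d) (mul.flip b) + TensorProduct.map (prec.flip d) (mul b) := by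
  ext; simp [tensorAssocMul]

theorem tensorAssocMul_tmul (prec succ : D →ₗ[k] D →ₗ[k] D) (mul : B →ₗ[k] B →ₗ[k] B)
    (d e : D) (a b : B) : tensorAssocMul prec succ mul (d ⊗ₜ a) (e ⊗ₜ b)
      = succ d e ⊗ₜ mul a b + prec d e ⊗ₜ mul b a := by
  simp [tensorAssocMul]

theorem tensorAssocMul_assoc {prec succ : D →ₗ[k] D →ₗ[k] D} {mul : B →ₗ[k] B →ₗ[k] B}
    (hD : IsDendriformAlgebra prec succ) (hB : IsPermAlgebra mul) (x y z : D ⊗[k] B) :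
    tensorAssocMul prec succ mul (tensorAssocMul prec succ mul x y) z
      = tensorAssocMul prec succ mul x (tensorAssocMul prec succ mul y z) := by
  induction x with
  | zero => simp
  | add x x' hx hx' => simp only [map_add, LinearMap.add_apply, hx, hx']
  | tmul d a =>
  induction y with
  | zero => simp
  | add y y' hy hy' => simp only [map_add, LinearMap.add_apply, hy, hy']
  | tmul e b =>
  induction z with
  | zero => simp
  | add z z' hz hz' => simp only [map_add, hz, hz']
  | tmul f c =>
  simp only [tensorAssocMul_tmul, map_add, LinearMap.add_apply, hD.succ_succ, hD.prec_prec,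
    hD.succ_prec, TensorProduct.add_tmul, ← hB.assoc, hB.mul_left_comm c]
  rw [hB.mul_left_comm b a c]
  abel

end

/-! ### The two brackets and cobrackets on `D ⊗ B` coincide -/

section
variable {k D B : Type*} [Field k] [AddCommGroup D] [Module k D] [AddCommGroup B] [Module k B]

theorem tensorLieBracket_preLieMul (prec succ : D →ₗ[k] D →ₗ[k] D) (mul : B →ₗ[k] B →ₗ[k] B) :
    tensorLieBracket (preLieMul prec succ) mul = commBracket (tensorAssocMul prec succ mul) := by
  refine TensorProduct.ext' fun d a => TensorProduct.ext' fun e b => ?_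
  rw [commBracket_apply, tensorAssocMul_tmul, tensorAssocMul_tmul]
  simp only [tensorLieBracket, LinearMap.sub_apply, TensorProduct.map₂_apply_tmul,
    TensorProduct.map_tmul, LinearMap.flip_apply, preLieMul_apply, TensorProduct.sub_tmul]
  abel

theorem tau_bullet (f : D →ₗ[k] D ⊗[k] D) (g : B →ₗ[k] B ⊗[k] B) :
    tau ∘ₗ bullet f g = bullet (tau ∘ₗ f) (tau ∘ₗ g) := by
  refine TensorProduct.ext' fun d b => ?_
  simp only [bullet, LinearMap.comp_apply, TensorProduct.map_tmul]
  induction f d with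
  | zero => simp
  | add x y hx hy => simp only [TensorProduct.add_tmul, map_add, hx, hy]
  | tmul d₁ d₂ =>
    induction g b with
    | zero => simp
    | add x y hx hy => simp only [TensorProduct.tmul_add, map_add, hx, hy]
    | tmul b₁ b₂ => simp [tau]

theorem tensorLieCobracket_preLieComul (thp ths : D →ₗ[k] D ⊗[k] D) (nu : B →ₗ[k] B ⊗[k] B) :
    tensorLieCobracket (preLieComul thp ths) nu = cocommutator (tensorAssocComul thp ths nu) := by
  refine TensorProduct.ext' fun d b => ?_
  simp only [tensorLieCobracket, cocommutator, tensorAssocComul, LinearMap.comp_add, tau_bullet,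
    preLieComul, LinearMap.comp_sub]
  simp only [bullet, LinearMap.sub_apply, LinearMap.add_apply, LinearMap.comp_apply,
    TensorProduct.map_tmul, tau_tau, TensorProduct.sub_tmul, map_sub]
  abel

end

/-! ### The ASI bialgebra on `D ⊗ B` -/

section
variable {k D B : Type*} [Field k] [AddCommGroup D] [Module k D] [AddCommGroup B] [Module k B]

/-- The map `D* ⊗ B → (D ⊗ B)*`, `ξ ⊗ p ↦ ξ ⊗ ω(p, ·)`. -/
def tensorDual (om : LinearMap.BilinForm k B) :
    Module.Dual k D ⊗[k] B →ₗ[k] Module.Dual k (D ⊗[k] B) :=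
  TensorProduct.dualDistrib k D B ∘ₗ om.lTensor (Module.Dual k D)

theorem tensorDual_tmul (om : LinearMap.BilinForm k B) (ξ : Module.Dual k D) (p : B) :
    tensorDual om (ξ ⊗ₜ p) = TensorProduct.dualDistrib k D B (ξ ⊗ₜ om p) := rfl

variable {prec succ : D →ₗ[k] D →ₗ[k] D} {thp ths : D →ₗ[k] D ⊗[k] D}
  {mul : B →ₗ[k] B →ₗ[k] B} {om : LinearMap.BilinForm k B}
  [FiniteDimensional k B]

theorem slice_tensorAssocComul (hB : IsQuadraticPermAlgebra mul om) (p q : B) (d : D) (b : B) :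
    slice (om p) (om q) (tensorAssocComul thp ths (formComul mul om hB.nondegenerate) (d ⊗ₜ b))
      = om (mul p q) b • ths d + om (mul q p) b • thp d := by
  rw [tensorAssocComul, LinearMap.add_apply, map_add, slice_bullet, slice_bullet,
    dualMul_tau_comp, LinearMap.flip_apply, hB.dualMul_formComul, hB.dualMul_formComul]

/-- The product dual to `Δ` is the product `∗` built from `B` and the dual dendriform algebra
`D*`. -/
theorem dualMul_tensorAssocComul (hB : IsQuadraticPermAlgebra mul om)
    (u v : Module.Dual k D ⊗[k] B) :
    dualMul (tensorAssocComul thp ths (formComul mul om hB.nondegenerate))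
        (tensorDual om u) (tensorDual om v)
      = tensorDual om (tensorAssocMul (dualMul thp) (dualMul ths) mul u v) := by
  induction u with
  | zero => simp
  | add x y hx hy => simp only [map_add, LinearMap.add_apply, hx, hy]
  | tmul ξ p =>
  induction v with
  | zero => simp
  | add x y hx hy => simp only [map_add, hx, hy]
  | tmul η q =>
  refine TensorProduct.ext' fun d b => ?_
  rw [tensorAssocMul_tmul, dualMul_apply, map_add, tensorDual_tmul, tensorDual_tmul,
    tensorDual_tmul, tensorDual_tmul, ← dualDistrib_slice, slice_tensorAssocComul hB, map_add,
    map_smul, map_smul, LinearMap.add_apply, TensorProduct.dualDistrib_apply,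
    TensorProduct.dualDistrib_apply, dualMul_apply, dualMul_apply, smul_eq_mul, smul_eq_mul]
  ring

variable [FiniteDimensional k D]

/-- The contractions with pairs `ω(p, ·)`, `ω(q, ·)` separate the points of `(D ⊗ B) ⊗ (D ⊗ B)`. -/
theorem ext_slice (h : om.Nondegenerate) {u v : (D ⊗[k] B) ⊗[k] (D ⊗[k] B)}
    (huv : ∀ p q, slice (om p) (om q) u = slice (om p) (om q) v) : u = v := by
  refine ext_dualDistrib fun φ ψ => ?_
  obtain ⟨w, rfl⟩ := (TensorProduct.dualDistribEquiv k D B).surjective φ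
  obtain ⟨w', rfl⟩ := (TensorProduct.dualDistribEquiv k D B).surjective ψ
  induction w with
  | zero => simp
  | add x y hx hy => simp only [map_add, TensorProduct.add_tmul, LinearMap.add_apply, hx, hy]
  | tmul ξ f =>
  induction w' with
  | zero => simp
  | add x y hx hy => simp only [map_add, TensorProduct.tmul_add, LinearMap.add_apply, hx, hy]
  | tmul η g =>
  obtain ⟨p, rfl⟩ := (om.toDual h).surjective f
  obtain ⟨q, rfl⟩ := (om.toDual h).surjective g
  have := congrArg (TensorProduct.dualDistrib k D D (ξ ⊗ₜ η)) (huv p q)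
  rwa [dualDistrib_slice, dualDistrib_slice] at this

theorem tensorDual_surjective (h : om.Nondegenerate) :
    Function.Surjective (tensorDual (D := D) om) :=
  (TensorProduct.dualDistribEquiv k D B).surjective.comp
    (LinearMap.lTensor_surjective _ (om.toDual h).surjective)

/-- `D ⊗ B` is an ASI bialgebra. The compatibility conditions are contracted with `ω(p, ·)` and
`ω(q, ·)` to identities in `D ⊗ D` whose coefficients are combinations of the scalars
`ω(a, p q b)`, `ω(a, b q p)` and `ω(a, b p q)`; the three resulting identities are combinations of
the compatibility conditions of `D`. -/
theorem IsDendriformDBialgebra.isASIBialgebra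
    (hD : IsDendriformDBialgebra prec succ thp ths) (hB : IsQuadraticPermAlgebra mul om) :
    IsASIBialgebra (tensorAssocMul prec succ mul)
      (tensorAssocComul thp ths (formComul mul om hB.nondegenerate)) where
  assoc := tensorAssocMul_assoc hD.algebra hB.perm
  coassoc := leftIter_eq_rightIter_of_dual fun ξ η ζ => by
    obtain ⟨u, rfl⟩ := tensorDual_surjective hB.nondegenerate ξ
    obtain ⟨v, rfl⟩ := tensorDual_surjective hB.nondegenerate η
    obtain ⟨w, rfl⟩ := tensorDual_surjective hB.nondegenerate ζ
    rw [dualMul_tensorAssocComul hB, dualMul_tensorAssocComul hB, dualMul_tensorAssocComul hB,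
      dualMul_tensorAssocComul hB, tensorAssocMul_assoc hD.coalgebra.dual hB.perm]
  compat₁ x y := by
    induction x with
    | zero => simp
    | add x x' hx hx' =>
      simp only [map_add, LinearMap.add_apply, LinearMap.lTensor_add, hx, hx']; abel
    | tmul d a =>
    induction y with
    | zero => simp
    | add y y' hy hy' =>
      simp only [map_add, LinearMap.add_apply, LinearMap.rTensor_add, hy, hy']; abel
    | tmul e b =>
    refine ext_slice hB.nondegenerate fun p q => ?_
    have h1 := hD.compat₁ d e
    have h2 := hD.compat₂ d e
    have h3 := hD.compat₃ d e
    rw [tensorAssocMul_tmul, tensorAssocMul_tmul_left, tensorAssocMul_flip_tmul]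
    simp only [LinearMap.rTensor_add, LinearMap.lTensor_add, LinearMap.add_apply, slice_rTensor_map,
      slice_lTensor_map, hB.comp_mul, hB.comp_mul_flip, slice_tensorAssocComul hB, map_add,
      map_smul, add_flip_apply] at h1 h2 h3 ⊢
    -- Bring the scalars into the form `ω(a, x y w)`, with a fixed order of `x` and `y`.
    simp only [map_sub, LinearMap.sub_apply, hB.form_mul_mul, hB.form_mul_mul_left,
      hB.form_mul_mul_right]
    simp only [hB.form_swap a, hB.form_cyc a, hB.form_cyc' a]
    simp only [hB.perm.mul_left_comm q p, hB.perm.mul_left_comm p b, hB.perm.mul_left_comm q b]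
    linear_combination (norm := module) om a (mul p (mul q b)) • (h1 + h2 - h3)
      - om a (mul b (mul q p)) • h1 - om a (mul b (mul p q)) • h2
  compat₂ x y := by
    induction x with
    | zero => simp
    | add x x' hx hx' =>
      simp only [map_add, LinearMap.add_apply, LinearMap.lTensor_add, LinearMap.rTensor_add,
        add_sub_add_comm, hx, hx']
    | tmul d a =>
    induction y with
    | zero => simp
    | add y y' hy hy' =>
      simp only [map_add, LinearMap.add_apply, LinearMap.lTensor_add, LinearMap.rTensor_add,
        add_sub_add_comm, hy, hy']
    | tmul e b =>
    refine ext_slice hB.nondegenerate fun p q => ?_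
    have h5 := hD.compat₅ d e
    have t5 := congrArg tau (hD.compat₅ e d)
    have t6 := congrArg tau (hD.compat₆ d e)
    rw [tensorAssocMul_tmul_left, tensorAssocMul_tmul_left, tensorAssocMul_flip_tmul,
      tensorAssocMul_flip_tmul]
    simp only [LinearMap.rTensor_add, LinearMap.lTensor_add, LinearMap.add_apply, slice_tau,
      slice_rTensor_map, slice_lTensor_map, hB.comp_mul, hB.comp_mul_flip,
      slice_tensorAssocComul hB, map_add, map_sub (slice _ _), map_sub tau, map_neg, tau_tau,
      map_smul, add_flip_apply, tau_rTensor, tau_lTensor] at h5 t5 t6 ⊢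
    -- Bring the scalars into the form `ω(a, x y w)`, with a fixed order of `x` and `y`.
    simp only [map_sub, LinearMap.sub_apply, hB.form_mul_mul_left, hB.form_mul_mul_right]
    simp only [hB.form_swap a, hB.form_cyc a, hB.form_cyc' a]
    simp only [hB.perm.mul_left_comm q p, hB.perm.mul_left_comm p b, hB.perm.mul_left_comm q b]
    linear_combination (norm := module) om a (mul p (mul q b)) • (h5 + t5 - t6)
      - om a (mul b (mul q p)) • h5 - om a (mul b (mul p q)) • t5

end

end

end DendBialg

theorem theoremI {k D B : Type*} [Field k] [CharZero k]
    [AddCommGroup D] [Module k D] [FiniteDimensional k D]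
    [AddCommGroup B] [Module k B] [FiniteDimensional k B]
    (prec succ : D →ₗ[k] D →ₗ[k] D) (thp ths : D →ₗ[k] D ⊗[k] D)
    (mul : B →ₗ[k] B →ₗ[k] B) (om : LinearMap.BilinForm k B)
    (hD : IsDendriformDBialgebra prec succ thp ths)
    (hB : IsQuadraticPermAlgebra mul om) :
    -- the left and the lower side of the square
    IsPreLieBialgebra (preLieMul prec succ) (preLieComul thp ths) ∧
    IsLieBialgebra (tensorLieBracket (preLieMul prec succ) mul)
      (tensorLieCobracket (preLieComul thp ths) (formComul mul om hB.nondegenerate)) ∧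
    -- the upper and the right side of the square
    IsASIBialgebra (tensorAssocMul prec succ mul)
      (tensorAssocComul thp ths (formComul mul om hB.nondegenerate)) ∧
    IsLieBialgebra (commBracket (tensorAssocMul prec succ mul))
      (cocommutator (tensorAssocComul thp ths (formComul mul om hB.nondegenerate))) ∧
    -- the two Lie bialgebras are the same
    tensorLieBracket (preLieMul prec succ) mul = commBracket (tensorAssocMul prec succ mul) ∧
    tensorLieCobracket (preLieComul thp ths) (formComul mul om hB.nondegenerate)
      = cocommutator (tensorAssocComul thp ths (formComul mul om hB.nondegenerate)) := by
  have hASI := hD.isASIBialgebra hB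
  have hLie := hASI.isLieBialgebra
  have hbr := tensorLieBracket_preLieMul prec succ mul
  have hco := tensorLieCobracket_preLieComul thp ths (formComul mul om hB.nondegenerate)
  exact ⟨hD.isPreLieBialgebra, hbr ▸ hco ▸ hLie, hASI, hLie, hbr, hco⟩
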